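/- Let $p \geq 5$ be a prime number and let $c_{A,B} \in \mathbb{F}_p[A,B]$ be the coefficient of $x^{p-1}$ in \[ \left(x^3 + Ax + B\right)^{\frac{p-1}{2}} \in \mathbb{F}_p[A,B][x]. \] Then $c_{A,B}$ is weighted homogeneous of degree $(p-1)/2$, where $A$ has weight $2$ and $B$ has weight $3$; it is nonzero; and it is absolutely squarefree, i.e. squarefree in $\overline{\mathbb{F}}_p[A,B]$, where $\overline{\mathbb{F}}_p$ is an algebraic closure of $\mathbb{F}_p$. Consequently, for every $\gamma \in \overline{\mathbb{F}}_p \setminus \{0\}$, the polynomial $c_{A,B} - \gamma \in \overline{\mathbb{F}}_p[A,B]$ is irreducible. -/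

import Mathlib

/-- The cubic `x³ + A x + B` as a polynomial in `x` over `𝔽_p[A, B]`, where `A` and `B` are the
variables of index `0` and `1`. -/
noncomputable def weierstrassCubic (p : ℕ) : Polynomial (MvPolynomial (Fin 2) (ZMod p)) :=
  Polynomial.X ^ 3 + Polynomial.C (MvPolynomial.X 0) * Polynomial.X
    + Polynomial.C (MvPolynomial.X 1)

/-- `c_{A,B} ∈ 𝔽_p[A, B]`: the coefficient of `x^(p-1)` in `(x³ + A x + B)^((p-1)/2)`. -/
noncomputable def cAB (p : ℕ) : MvPolynomial (Fin 2) (ZMod p) :=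
  ((weierstrassCubic p) ^ ((p - 1) / 2)).coeff (p - 1)

/-- A polynomial over a field `k` is absolutely squarefree if it is squarefree as a polynomial
over the algebraic closure of `k`. -/
def AbsolutelySquarefree {σ k : Type*} [Field k] (f : MvPolynomial σ k) : Prop :=
  Squarefree (MvPolynomial.map (algebraMap k (AlgebraicClosure k)) f)

/-! Write `n = (p-1)/2`, `F = x³ + Ax + B`, `Δ = 4A³ + 27B²`, and `c` for the coefficient of
`x^(2n)` in `F^n`. Since `n = -1/2` in characteristic `p`, `F^n` behaves like `1/y` on `y² = F`, and
`c` satisfies the Picard–Fuchs equation `4D²c = 3Ac`, where `D = 9B∂_A - 2A²∂_B`.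

Suppose a prime `h` divides `c` at least twice. Its multiplicity is at most `n < p`, so the equation
forces `h ∣ Dh`, and Euler's relation forces `h ∣ Eh` with `E = 2A∂_A + 3B∂_B`. The determinant of
`D` and `E` is `Δ`, so `h` divides `Δ∂_A h` and `Δ∂_B h`. But `h ∤ Δ`, because `c` takes the nonzero
value `3^n` on the nodal cubic and singular cubics are rescalings of it, up to the cusp. So `h`
divides its own partial derivatives; they vanish by degree, and `deg h < p` makes `h` constant.

For `c - γ`, the weighted scaling by `t` gives `t^n c - γ`. Its reversal in `t` is Eisenstein at any
prime factor of `c`, which is simple by squarefreeness. -/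

open MvPolynomial

/-! ### The middle coefficient and its weighted homogeneity -/

/-- The cubic `x³ + A x + B` over `R[A, B]`. -/
noncomputable def genericCubic (R : Type*) [CommRing R] : Polynomial (MvPolynomial (Fin 2) R) :=
  Polynomial.X ^ 3 + Polynomial.C (X 0) * Polynomial.X + Polynomial.C (X 1)

/-- The coefficient of `x^(2n)` in `(x³ + A x + B)^n`. -/
noncomputable def middleCoeff (R : Type*) [CommRing R] (n : ℕ) : MvPolynomial (Fin 2) R :=
  (genericCubic R ^ n).coeff (2 * n)

theorem map_middleCoeff {R S : Type*} [CommRing R] [CommRing S] (f : R →+* S) (n : ℕ) :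
    map f (middleCoeff R n) = middleCoeff S n := by
  unfold middleCoeff
  rw [← Polynomial.coeff_map, Polynomial.map_pow]
  congr 2
  simp [genericCubic]

theorem natDegree_genericCubic_pow_le (R : Type*) [CommRing R] (n : ℕ) :
    (genericCubic R ^ n).natDegree ≤ 3 * n := by
  have h : (genericCubic R).natDegree ≤ 3 := by
    unfold genericCubic
    compute_degree
  calc _ ≤ n * (genericCubic R).natDegree := Polynomial.natDegree_pow_le
    _ ≤ 3 * n := by nlinarith

/-- With `x` in weight 1 the cubic is homogeneous of weight 3. All coefficients are treated at once
because the induction on `N` shifts the index. -/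
theorem isWeightedHomogeneous_coeff_genericCubic_pow (R : Type*) [CommRing R] (N : ℕ) :
    ∀ m d : ℕ, m + d = 3 * N →
      IsWeightedHomogeneous (![2, 3] : Fin 2 → ℕ) ((genericCubic R ^ N).coeff m) d := by
  induction N with
  | zero =>
    intro m d h
    obtain ⟨rfl, rfl⟩ : m = 0 ∧ d = 0 := by omega
    simpa using isWeightedHomogeneous_one R (![2, 3] : Fin 2 → ℕ)
  | succ N ih =>
    intro m d h
    have hA : IsWeightedHomogeneous (![2, 3] : Fin 2 → ℕ) (X 0 : MvPolynomial (Fin 2) R) 2 :=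
      isWeightedHomogeneous_X R _ 0
    have hB : IsWeightedHomogeneous (![2, 3] : Fin 2 → ℕ) (X 1 : MvPolynomial (Fin 2) R) 3 :=
      isWeightedHomogeneous_X R _ 1
    have hzero := isWeightedHomogeneous_zero R (![2, 3] : Fin 2 → ℕ) d
    have hvanish : ∀ k, 3 * N < k → (genericCubic R ^ N).coeff k = 0 := fun k hk =>
      Polynomial.coeff_eq_zero_of_natDegree_lt
        ((natDegree_genericCubic_pow_le R N).trans_lt hk)
    have hexp : genericCubic R ^ (N + 1) = Polynomial.X ^ 3 * genericCubic R ^ N +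
        Polynomial.C (X 0) * (Polynomial.X ^ 1 * genericCubic R ^ N) +
        Polynomial.C (X 1) * genericCubic R ^ N := by
      rw [pow_succ', genericCubic]; ring
    rw [hexp, Polynomial.coeff_add, Polynomial.coeff_add, Polynomial.coeff_C_mul,
      Polynomial.coeff_C_mul, Polynomial.coeff_X_pow_mul', Polynomial.coeff_X_pow_mul']
    refine (IsWeightedHomogeneous.add ?_ ?_).add ?_
    · split_ifs with h3
      · exact ih _ _ (by omega)
      · exact hzero
    · split_ifs with h1
      · by_cases hd : 2 ≤ d
        · have := hA.mul (ih (m - 1) (d - 2) (by omega))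
          rwa [show 2 + (d - 2) = d by omega] at this
        · rw [hvanish _ (by omega), mul_zero]; exact hzero
      · rw [mul_zero]; exact hzero
    · by_cases hd : 3 ≤ d
      · have := hB.mul (ih m (d - 3) (by omega))
        rwa [show 3 + (d - 3) = d by omega] at this
      · rw [hvanish _ (by omega), mul_zero]; exact hzero

theorem isWeightedHomogeneous_middleCoeff (R : Type*) [CommRing R] (n : ℕ) :
    IsWeightedHomogeneous (![2, 3] : Fin 2 → ℕ) (middleCoeff R n) n :=
  isWeightedHomogeneous_coeff_genericCubic_pow R n _ _ (by omega)

/-- Rescaling the variables of a weighted homogeneous polynomial. -/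
theorem MvPolynomial.IsWeightedHomogeneous.aeval_pow_mul {σ R S : Type*} [CommRing R] [CommRing S]
    [Algebra R S] {w : σ → ℕ} {f : MvPolynomial σ R} {n : ℕ} (hf : IsWeightedHomogeneous w f n)
    (t : S) (x : σ → S) : aeval (fun i => t ^ w i * x i) f = t ^ n * aeval x f := by
  induction hf using IsWeightedHomogeneous.induction_on with
  | zero => simp
  | add p q _ _ hp hq => rw [map_add, map_add, hp, hq, mul_add]
  | monomial d r hr =>
    rw [aeval_monomial, aeval_monomial, ← hr, Finsupp.weight_apply, Finsupp.prod, Finsupp.prod,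
      Finsupp.sum]
    simp only [mul_pow, Finset.prod_mul_distrib, ← pow_mul, smul_eq_mul,
      Finset.prod_pow_eq_pow_sum]
    rw [Finset.sum_congr rfl fun i _ => mul_comm (w i) (d i)]
    ring

theorem aeval_middleCoeff {R S : Type*} [CommRing R] [CommRing S] [Algebra R S] (n : ℕ)
    (a b : S) : aeval ![a, b] (middleCoeff R n) =
      ((Polynomial.X ^ 3 + Polynomial.C a * Polynomial.X + Polynomial.C b) ^ n).coeff (2 * n) := by
  unfold middleCoeff
  have := Polynomial.coeff_map (p := genericCubic R ^ n)
    ((aeval ![a, b] : MvPolynomial (Fin 2) R →ₐ[R] S) : MvPolynomial (Fin 2) R →+* S) (2 * n)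
  rw [RingHom.coe_coe] at this
  rw [← this, Polynomial.map_pow]
  congr 2
  simp [genericCubic]

/-! ### Value on the nodal cubic -/

theorem Polynomial.X_sub_one_pow_char_sub_one {S : Type*} [CommRing S] [IsDomain S]
    (p : ℕ) [Fact p.Prime] [CharP S p] :
    (Polynomial.X - 1 : Polynomial S) ^ (p - 1) = ∑ i ∈ Finset.range p, Polynomial.X ^ i := by
  have hp := Fact.out (p := p.Prime)
  have h1 : (Polynomial.X - 1 : Polynomial S) ≠ 0 := by simpa using Polynomial.X_sub_C_ne_zero (1 : S)
  apply mul_right_cancel₀ h1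
  rw [geom_sum_mul, ← pow_succ, Nat.sub_add_cancel hp.one_le, sub_pow_char, one_pow]

/-- On the nodal cubic `(x - 1)² (x + 2) = x³ - 3 x + 2` the coefficient is nonzero. -/
theorem aeval_middleCoeff_nodal {R S : Type*} [CommRing R] [CommRing S] [IsDomain S] [Algebra R S]
    (p : ℕ) [Fact p.Prime] [CharP S p] (n : ℕ) (hn : 2 * n + 1 = p) :
    aeval ![(-3 : S), 2] (middleCoeff R n) = 3 ^ n := by
  have hfac : (Polynomial.X ^ 3 + Polynomial.C (-3 : S) * Polynomial.X + Polynomial.C 2) ^ n = (∑ i ∈ Finset.range p, Polynomial.X ^ i) * (Polynomial.X + Polynomial.C 2) ^ n := by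
    rw [← Polynomial.X_sub_one_pow_char_sub_one, show p - 1 = 2 * n by omega, pow_mul, ← mul_pow]
    congr 1
    simp only [map_neg, map_ofNat]
    ring
  have hdeg : ((Polynomial.X + Polynomial.C (2 : S)) ^ n).natDegree < 2 * n + 1 := by
    rw [Polynomial.natDegree_pow, Polynomial.natDegree_X_add_C]; omega
  have heval : ((Polynomial.X + Polynomial.C (2 : S)) ^ n).eval 1 = 3 ^ n := by
    simp only [Polynomial.eval_pow, Polynomial.eval_add, Polynomial.eval_X, Polynomial.eval_C]; norm_num
  -- The `x^(2n)` coefficient of `(1 + x + ... + x^(2n)) g` with `deg g ≤ 2n` is the sum of all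
  -- coefficients of `g`, that is `g(1)`.
  rw [aeval_middleCoeff, hfac, Finset.sum_mul, Polynomial.finsetSum_coeff, ← heval,
    Polynomial.eval_eq_sum_range' hdeg, ← Finset.sum_range_reflect, ← hn]
  refine Finset.sum_congr rfl fun i hi => ?_
  rw [Finset.mem_range] at hi
  rw [Polynomial.coeff_X_pow_mul', if_pos (by omega), one_pow, mul_one]
  congr 1
  omega

/-! ### The Picard–Fuchs equation -/

/-- The derivation `9 B ∂/∂A - 2 A² ∂/∂B`, which annihilates the discriminant `4 A³ + 27 B²`. -/
noncomputable def discDerivation (R : Type*) [CommRing R] :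
    Derivation R (MvPolynomial (Fin 2) R) (MvPolynomial (Fin 2) R) :=
  (9 * X 1 : MvPolynomial (Fin 2) R) • pderiv 0 - (2 * X 0 ^ 2 : MvPolynomial (Fin 2) R) • pderiv 1

theorem discDerivation_apply {R : Type*} [CommRing R] (f : MvPolynomial (Fin 2) R) :
    discDerivation R f = 9 * X 1 * pderiv 0 f - 2 * X 0 ^ 2 * pderiv 1 f := by
  simp [discDerivation]

theorem discDerivation_X_zero (R : Type*) [CommRing R] :
    discDerivation R (X 0) = 9 * X 1 := by
  simp [discDerivation_apply, pderiv_X]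

theorem discDerivation_X_one (R : Type*) [CommRing R] :
    discDerivation R (X 1) = -2 * X 0 ^ 2 := by
  simp [discDerivation_apply, pderiv_X]

/-- The Picard–Fuchs equation: `4 D² c = 3 A c` for `D = 9 B ∂/∂A - 2 A² ∂/∂B`. -/
theorem discDerivation_discDerivation_middleCoeff {R : Type*} [CommRing R] (k : ℕ)
    (hk : (2 * k + 5 : R) = 0) :
    4 * discDerivation R (discDerivation R (middleCoeff R (k + 2))) =
      3 * X 0 * middleCoeff R (k + 2) := by
  -- The derivation is extended to polynomials in `x` coefficientwise, so that `x` is a constant.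
  let _ : Differential (MvPolynomial (Fin 2) R) := ⟨(discDerivation R).restrictScalars ℤ⟩
  let D := Differential.mapCoeffs (A := MvPolynomial (Fin 2) R)
  have hderiv : ∀ f : MvPolynomial (Fin 2) R, Differential.deriv f = discDerivation R f :=
    fun _ => rfl
  let x : Polynomial (MvPolynomial (Fin 2) R) := Polynomial.X
  let a : Polynomial (MvPolynomial (Fin 2) R) := Polynomial.C (X 0)
  let b : Polynomial (MvPolynomial (Fin 2) R) := Polynomial.C (X 1)
  let F := genericCubic R
  let G := 9 * b * x - 2 * a ^ 2
  let Q := 3 * a * x ^ 4 - 3 * a ^ 2 * x ^ 2 - 6 * a * b * x - 4 * a ^ 3 - 27 * b ^ 2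
  have hF : F = x ^ 3 + a * x + b := rfl
  have hDx : D x = 0 := Differential.mapCoeffs_X
  have hDa : D a = 9 * b := by
    simp only [D, a, Differential.mapCoeffs_C, hderiv, discDerivation_X_zero]; simp [b, map_ofNat]
  have hDb : D b = -2 * a ^ 2 := by
    simp only [D, b, Differential.mapCoeffs_C, hderiv, discDerivation_X_one]; simp [a, map_ofNat]
  have hDF : D F = G := by
    simp only [hF, map_add, Derivation.leibniz, Derivation.leibniz_pow, hDx, hDa, hDb, G,
      smul_eq_mul, nsmul_eq_mul]
    ring
  have hDG : D G = -18 * a ^ 2 * x - 36 * a * b := by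
    have h9 : D 9 = 0 := D.map_natCast 9
    have h2 : D 2 = 0 := D.map_natCast 2
    simp only [G, map_sub, Derivation.leibniz, Derivation.leibniz_pow, hDx, hDa, hDb, h9, h2,
      smul_eq_mul, nsmul_eq_mul]
    push_cast
    ring
  have hDDF : D (D (F ^ (k + 2))) =
      (k + 2) * ((k + 1) * F ^ k * G ^ 2 + F ^ (k + 1) * D G) := by
    rw [Derivation.leibniz_pow, map_nsmul, hDF, smul_eq_mul, Derivation.leibniz,
      Derivation.leibniz_pow, show k + 2 - 1 = k + 1 by omega, Nat.add_sub_cancel, hDF]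
    simp only [smul_eq_mul, nsmul_eq_mul]
    push_cast
    ring
  have hder : Polynomial.derivative (2 * Q * F ^ (k + 1)) =
      2 * (12 * a * x ^ 3 - 6 * a ^ 2 * x - 6 * a * b) * F ^ (k + 1) +
        2 * Q * (((k : Polynomial (MvPolynomial (Fin 2) R)) + 1) * F ^ k * (3 * x ^ 2 + a)) := by
    simp only [Q, hF, x, a, b, Polynomial.derivative_mul, Polynomial.derivative_pow,
      Polynomial.derivative_add, Polynomial.derivative_sub, Polynomial.derivative_C,
      Polynomial.derivative_X, Polynomial.derivative_ofNat]
    simp only [Nat.add_sub_cancel, map_natCast]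
    push_cast
    ring
  have hkP : (2 * k + 5 : Polynomial (MvPolynomial (Fin 2) R)) = 0 := by
    have := congrArg (fun r => Polynomial.C (C r : MvPolynomial (Fin 2) R)) hk
    simpa [map_ofNat] using this
  -- `Q` makes the Picard–Fuchs operator applied to `F^n`, `n = k + 2`, exact in `x`. The identity
  -- holds only modulo `2k + 5 = 2n + 1`, hence the multiple of `hkP`.
  have key : 4 * D (D (F ^ (k + 2))) - 3 * a * F ^ (k + 2) =
      Polynomial.derivative (2 * Q * F ^ (k + 1)) := by
    rw [hDDF, hDG, hder]
    simp only [pow_succ F]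
    generalize F ^ k = E
    rw [hF]
    simp only [G, Q]
    linear_combination (E * ((2 * k + 1) * (9 * b * x - 2 * a ^ 2) ^ 2 +
      2 * (x ^ 3 + a * x + b) * (-18 * a ^ 2 * x - 36 * a * b) -
      (3 * a * x ^ 4 - 3 * a ^ 2 * x ^ 2 - 6 * a * b * x - 4 * a ^ 3 - 27 * b ^ 2) *
        (3 * x ^ 2 + a))) * hkP
  have hcoeff := congrArg (fun P => P.coeff (2 * (k + 2))) key
  have hkA : (2 * k + 5 : MvPolynomial (Fin 2) R) = 0 := by
    simpa [map_ofNat] using congrArg (C : R → MvPolynomial (Fin 2) R) hk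
  -- The `x^(2n)` coefficient of a derivative carries the factor `2n + 1 = 0`, so the exact term
  -- disappears.
  have hz : ((2 * (k + 2) : ℕ) + 1 : MvPolynomial (Fin 2) R) = 0 := by
    push_cast
    linear_combination hkA
  rw [show (4 : Polynomial (MvPolynomial (Fin 2) R)) = Polynomial.C 4 from (map_ofNat _ 4).symm,
    show 3 * a = Polynomial.C (3 * X 0) by simp [a, map_ofNat]] at hcoeff
  simp only [Polynomial.coeff_sub, Polynomial.coeff_C_mul, Polynomial.coeff_derivative, hz,
    mul_zero, D, Differential.coeff_mapCoeffs, hderiv] at hcoeff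
  exact sub_eq_zero.mp hcoeff

/-! ### Degrees, derivations and multiplicities of primes -/

theorem MvPolynomial.totalDegree_pderiv_lt {σ R : Type*} [CommRing R] {f : MvPolynomial σ R}
    {i : σ} (h : pderiv i f ≠ 0) : (pderiv i f).totalDegree < f.totalDegree := by
  have key : ∀ m ∈ (pderiv i f).support, m.degree < f.totalDegree := by
    intro m hm
    rw [mem_support_iff, coeff_pderiv] at hm
    have := le_totalDegree (mem_support_iff.mpr (left_ne_zero_of_mul hm))
    have hdeg : (m + Finsupp.single i 1).degree = m.degree + 1 := by simp
    change (m + Finsupp.single i 1).degree ≤ _ at this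
    omega
  obtain ⟨m, hm⟩ := support_nonempty.mpr h
  exact (Finset.sup_lt_iff ((Nat.zero_le _).trans_lt (key m hm))).mpr key

theorem MvPolynomial.pderiv_eq_zero_of_dvd {σ R : Type*} [CommRing R] [IsDomain R]
    {f : MvPolynomial σ R} {i : σ} (h : f ∣ pderiv i f) : pderiv i f = 0 := by
  by_contra h0
  obtain ⟨g, hg⟩ := h
  have h1 := totalDegree_pderiv_lt h0
  rw [hg] at h0 h1
  rw [totalDegree_mul_of_isDomain (left_ne_zero_of_mul h0) (right_ne_zero_of_mul h0)] at h1
  omega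

/-- Each exponent is below `p`, so a nonzero one stays nonzero in `R` and is detected by a partial
derivative. -/
theorem MvPolynomial.totalDegree_eq_zero_of_pderiv_eq_zero {σ R : Type*} [CommRing R] [IsDomain R]
    (p : ℕ) [CharP R p] {f : MvPolynomial σ R} (hdeg : f.totalDegree < p)
    (h : ∀ i, pderiv i f = 0) : f.totalDegree = 0 := by
  rw [totalDegree_eq_zero_iff]
  intro m hm i
  by_contra hi
  have hmi : Finsupp.single i 1 ≤ m := by
    rw [Finsupp.single_le_iff]; omega
  have hc := congrArg (coeff (m - Finsupp.single i 1)) (h i)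
  rw [coeff_pderiv, tsub_add_cancel_of_le hmi, coeff_zero] at hc
  have hcast : (((m - Finsupp.single i 1 : σ →₀ ℕ) i : R) + 1) = (m i : R) := by
    rw [← Nat.cast_succ]
    congr 1
    simp only [Finsupp.tsub_apply, Finsupp.single_eq_same]
    omega
  rw [hcast] at hc
  have h0 := (mul_eq_zero.mp hc).resolve_left (mem_support_iff.mp hm)
  rw [CharP.cast_eq_zero_iff R p] at h0
  have h1 := Nat.le_of_dvd (Nat.pos_of_ne_zero hi) h0
  have h2 : m i ≤ f.totalDegree := (Finsupp.le_degree i m).trans (le_totalDegree hm)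
  omega

theorem MvPolynomial.totalDegree_pow_of_isDomain {σ R : Type*} [CommRing R] [IsDomain R]
    {f : MvPolynomial σ R} (hf : f ≠ 0) (n : ℕ) : (f ^ n).totalDegree = n * f.totalDegree := by
  induction n with
  | zero => simp
  | succ n ih =>
    rw [pow_succ, totalDegree_mul_of_isDomain (pow_ne_zero n hf) hf, ih]
    ring

theorem Derivation.map_pow_succ_mul {R A : Type*} [CommRing R] [CommRing A] [Algebra R A]
    (δ : Derivation R A A) (h u : A) (m : ℕ) :
    δ (h ^ (m + 1) * u) = h ^ m * ((m + 1) * u * δ h + h * δ u) := by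
  rw [Derivation.leibniz, Derivation.leibniz_pow, Nat.add_sub_cancel]
  simp only [smul_eq_mul, nsmul_eq_mul]
  push_cast
  ring

/-- If `h^(m+1) ∣ r · δ(h^(m+1) u)` with `h` a prime not dividing `r (m+1) u`, then `h ∣ δ h`. -/
theorem Prime.dvd_derivation_of_pow_dvd {R A : Type*} [CommRing R] [CommRing A] [IsDomain A]
    [Algebra R A] (δ : Derivation R A A) {h u r : A} {m : ℕ} (hh : Prime h) (hu : ¬ h ∣ u)
    (hr : ¬ h ∣ r) (hm : ¬ h ∣ (m + 1 : A))
    (hd : h ^ (m + 1) ∣ r * δ (h ^ (m + 1) * u)) : h ∣ δ h := by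
  rw [δ.map_pow_succ_mul, mul_left_comm, pow_succ] at hd
  have h1 := (hh.dvd_mul.mp ((mul_dvd_mul_iff_left (pow_ne_zero m hh.ne_zero)).mp hd)).resolve_left
    hr
  rw [dvd_add_left (dvd_mul_right _ _)] at h1
  exact (hh.dvd_mul.mp h1).resolve_left fun h2 => (hh.dvd_mul.mp h2).elim hm hu

/-- If `h^(m+2) ∣ r · δ²(h^(m+2) u)` with `h` a prime not dividing `r (m+1) (m+2) u`,
then `h ∣ δ h`. -/
theorem Prime.dvd_derivation_of_pow_dvd_derivation {R A : Type*} [CommRing R] [CommRing A]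
    [IsDomain A] [Algebra R A] (δ : Derivation R A A) {h u r : A} {m : ℕ} (hh : Prime h)
    (hu : ¬ h ∣ u) (hr : ¬ h ∣ r) (hm₁ : ¬ h ∣ (m + 1 : A)) (hm₂ : ¬ h ∣ (m + 2 : A))
    (hd : h ^ (m + 2) ∣ r * δ (δ (h ^ (m + 2) * u))) : h ∣ δ h := by
  rw [show m + 2 = m + 1 + 1 from rfl, δ.map_pow_succ_mul h u (m + 1)] at hd
  -- This is the cofactor `v` in `δ(h^(m+2) u) = h^(m+1) v`. If `h ∤ v`, the first-order lemma
  -- applies with `v` in place of `u`.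
  by_cases hv : h ∣ ((m + 1 : ℕ) + 1) * u * δ h + h * δ u
  · rw [dvd_add_left (dvd_mul_right _ _)] at hv
    refine (hh.dvd_mul.mp hv).resolve_left fun h2 => (hh.dvd_mul.mp h2).elim (fun h3 => hm₂ ?_) hu
    convert h3 using 1
    push_cast
    ring
  · exact hh.dvd_derivation_of_pow_dvd δ hv hr hm₁ ((pow_dvd_pow h (Nat.le_succ _)).trans hd)

/-! ### Squarefreeness -/

theorem totalDegree_middleCoeff_le (R : Type*) [CommRing R] (n : ℕ) :
    (middleCoeff R n).totalDegree ≤ n := by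
  refine Finset.sup_le fun d hd => ?_
  have := isWeightedHomogeneous_middleCoeff R n (mem_support_iff.mp hd)
  rw [Finsupp.weight_apply, Finsupp.sum_fintype _ _ (by simp)] at this
  rw [Finsupp.sum_fintype _ _ (by simp)]
  simp only [Fin.sum_univ_two, smul_eq_mul, Matrix.cons_val_zero, Matrix.cons_val_one] at this ⊢
  omega

theorem Prime.not_dvd_C {σ K : Type*} [Field K] {h : MvPolynomial σ K} (hh : Prime h) {r : K}
    (hr : r ≠ 0) : ¬ h ∣ C r := fun hd =>
  hh.not_isUnit (isUnit_of_dvd_unit hd ((Ne.isUnit hr).map C))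

theorem CharP.natCast_ne_zero_of_lt (R : Type*) [Ring R] (p : ℕ) [CharP R p] {m : ℕ} (hm : m ≠ 0)
    (hmp : m < p) : (m : R) ≠ 0 := by
  rw [Ne, CharP.cast_eq_zero_iff R p]
  exact Nat.not_dvd_of_pos_of_lt (Nat.pos_of_ne_zero hm) hmp

section

variable {K : Type*} [Field K] (p : ℕ) [Fact p.Prime] [CharP K p]

theorem aeval_middleCoeff_nodal_ne_zero {n : ℕ} (hn : 2 * n + 1 = p) (hp : 5 ≤ p) :
    aeval ![(-3 : K), 2] (middleCoeff K n) ≠ 0 := by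
  rw [aeval_middleCoeff_nodal p n hn]
  exact pow_ne_zero _ (by
    exact_mod_cast CharP.natCast_ne_zero_of_lt K p (m := 3) (by omega) (by omega))

theorem middleCoeff_ne_zero {n : ℕ} (hn : 2 * n + 1 = p) (hp : 5 ≤ p) : middleCoeff K n ≠ 0 :=
  fun h => aeval_middleCoeff_nodal_ne_zero (K := K) p hn hp (by rw [h, map_zero])

/-- No prime divides both the coefficient and the discriminant. -/
theorem Prime.not_dvd_disc_of_dvd_middleCoeff {n : ℕ} (hn : 2 * n + 1 = p) (hp : 5 ≤ p)
    {h : MvPolynomial (Fin 2) K} (hh : Prime h) (hc : h ∣ middleCoeff K n) :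
    ¬ h ∣ 4 * X 0 ^ 3 + 27 * X 1 ^ 2 := by
  intro hdisc
  have hprime : (Ideal.span {h}).IsPrime := (Ideal.span_singleton_prime hh.ne_zero).mpr hh
  let π := Ideal.Quotient.mkₐ K (Ideal.span {h})
  have hπ : ∀ f, π f = 0 ↔ h ∣ f := fun f =>
    Ideal.Quotient.eq_zero_iff_mem.trans Ideal.mem_span_singleton
  let S := MvPolynomial (Fin 2) K ⧸ Ideal.span {h}
  have : CharP S p := charP_of_injective_algebraMap (algebraMap K S).injective p
  have h2 : (2 : S) ≠ 0 := by exact_mod_cast CharP.natCast_ne_zero_of_lt S p (m := 2) (by omega) (by omega)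
  have h3 : (3 : S) ≠ 0 := by exact_mod_cast CharP.natCast_ne_zero_of_lt S p (m := 3) (by omega) (by omega)
  let a := π (X 0)
  let b := π (X 1)
  have hab : 4 * a ^ 3 + 27 * b ^ 2 = 0 := by
    have := (hπ _).mpr hdisc
    simpa only [map_add, map_mul, map_pow, map_ofNat] using this
  have hcab : aeval ![a, b] (middleCoeff K n) = 0 := by
    have := (hπ _).mpr hc
    have hext : aeval ![a, b] = π := by
      apply MvPolynomial.algHom_ext
      intro i
      fin_cases i <;> simp [a, b]
    rwa [hext]
  have hhom := isWeightedHomogeneous_middleCoeff K n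
  have e1 := hhom.aeval_pow_mul (2 * a) ![a, b]
  have e2 := hhom.aeval_pow_mul (-3 * b) ![(-3 : S), 2]
  -- On `Δ = 0` one has `(a, b) = (-3s², 2s³)` with `s = -3b/(2a)`. Denominators are cleared, which
  -- also covers `a = 0`.
  have heq : (fun i => (2 * a) ^ (![2, 3] : Fin 2 → ℕ) i * ![a, b] i) =
      fun i => (-3 * b) ^ (![2, 3] : Fin 2 → ℕ) i * ![(-3 : S), 2] i := by
    funext i
    fin_cases i
    · simp only [Fin.zero_eta, Matrix.cons_val_zero]
      linear_combination hab
    · simp only [Fin.mk_one, Matrix.cons_val_one, Matrix.cons_val_zero]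
      linear_combination 2 * b * hab
  rw [heq, e2, hcab, mul_zero, aeval_middleCoeff_nodal p n hn] at e1
  have hb : b = 0 := by
    have := (mul_eq_zero.mp e1).resolve_right (pow_ne_zero _ h3)
    have := eq_zero_of_pow_eq_zero this
    exact (mul_eq_zero.mp this).resolve_left (neg_ne_zero.mpr h3)
  have ha : a = 0 := by
    have h4 : (4 : S) ≠ 0 := by
      rw [show (4 : S) = 2 * 2 by norm_num]; exact mul_ne_zero h2 h2
    rw [hb] at hab
    have : 4 * a ^ 3 = 0 := by linear_combination hab
    exact eq_zero_of_pow_eq_zero ((mul_eq_zero.mp this).resolve_left h4)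
  have hA : h ∣ X 0 := (hπ _).mp ha
  have hB : h ∣ X 1 := (hπ _).mp hb
  have hassoc := (hh.irreducible.dvd_symm (X_prime (i := (0 : Fin 2))).irreducible hA)
  exact absurd (X_dvd_X.mp (hassoc.trans hB)) (by simp)

/-- The coefficient of `x^(p-1)` in `(x³ + A x + B)^((p-1)/2)` is squarefree. -/
theorem squarefree_middleCoeff {n : ℕ} (hn : 2 * n + 1 = p) (hp : 5 ≤ p) :
    Squarefree (middleCoeff K n) := by
  have hc0 := middleCoeff_ne_zero (K := K) p hn hp
  rw [squarefree_iff_irreducible_sq_not_dvd_of_ne_zero hc0]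
  intro h hirr hsq
  have hh : Prime h := hirr.prime
  have hfin := FiniteMultiplicity.of_prime_left hh hc0
  obtain ⟨u, hM, hu⟩ := hfin.exists_eq_pow_mul_and_not_dvd
  have hM2 : 2 ≤ multiplicity h (middleCoeff K n) :=
    hfin.le_multiplicity_of_pow_dvd (by rwa [sq])
  obtain ⟨m, hm⟩ := Nat.exists_eq_add_of_le' hM2
  rw [hm] at hM
  have hu0 : u ≠ 0 := fun h0 => hu (h0 ▸ dvd_zero h)
  have hdeg := totalDegree_middleCoeff_le K n
  rw [hM, totalDegree_mul_of_isDomain (pow_ne_zero _ hh.ne_zero) hu0,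
    totalDegree_pow_of_isDomain hh.ne_zero] at hdeg
  have hh0 : h.totalDegree ≠ 0 := fun h0 => by
    rw [totalDegree_eq_zero_iff_eq_C] at h0
    have hne : coeff 0 h ≠ 0 := fun h1 => hh.ne_zero (by rw [h0, h1, C_0])
    exact hh.not_dvd_C hne (by rw [← h0])
  have hmn : m + 2 ≤ n := by nlinarith [Nat.pos_of_ne_zero hh0]
  have hhn : h.totalDegree ≤ n := by nlinarith
  have hcast : ∀ r : ℕ, r ≠ 0 → r < p → ¬ h ∣ (r : MvPolynomial (Fin 2) K) := fun r hr hrp => by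
    rw [← map_natCast (C : K →+* MvPolynomial (Fin 2) K)]
    exact hh.not_dvd_C (CharP.natCast_ne_zero_of_lt K p hr hrp)
  have hm1 := hcast (m + 1) (by omega) (by omega)
  have hm2 := hcast (m + 2) (by omega) (by omega)
  have hm4 := hcast 4 (by omega) (by omega)
  have hm1' := hcast 1 (by omega) (by omega)
  push_cast at hm1 hm2 hm4 hm1'
  have hdvd : h ^ (m + 2) ∣ middleCoeff K n := ⟨u, hM⟩
  have hD : h ∣ discDerivation K h := by
    refine hh.dvd_derivation_of_pow_dvd_derivation _ hu hm4 hm1 hm2 ?_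
    obtain ⟨k, rfl⟩ := Nat.exists_eq_add_of_le' (show 2 ≤ n by omega)
    rw [← hM, discDerivation_discDerivation_middleCoeff k]
    · exact hdvd.mul_left _
    · rw [← CharP.cast_eq_zero K p, ← hn]
      push_cast
      ring
  have hE : h ∣ 2 * X 0 * pderiv 0 h + 3 * X 1 * pderiv 1 h := by
    let E : Derivation K (MvPolynomial (Fin 2) K) (MvPolynomial (Fin 2) K) :=
      (2 * X 0 : MvPolynomial (Fin 2) K) • pderiv 0 +
        (3 * X 1 : MvPolynomial (Fin 2) K) • pderiv 1
    have hEapp : ∀ f, E f = 2 * X 0 * pderiv 0 f + 3 * X 1 * pderiv 1 f := fun f => by simp [E]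
    have hEuler := (isWeightedHomogeneous_middleCoeff K n).sum_weight_X_mul_pderiv
    simp only [Fin.sum_univ_two, Matrix.cons_val_zero, Matrix.cons_val_one, nsmul_eq_mul,
      ← mul_assoc] at hEuler
    push_cast at hEuler
    rw [← hEapp] at hEuler ⊢
    refine hh.dvd_derivation_of_pow_dvd E (m := m + 1) hu hm1' ?_ ?_
    · push_cast
      rwa [add_assoc, one_add_one_eq_two]
    · rw [one_mul, ← hM, hEuler]
      exact hdvd.mul_left _
  rw [discDerivation_apply] at hD
  have hc : h ∣ middleCoeff K n := (dvd_pow_self h (by omega)).trans hdvd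
  have hdisc := hh.not_dvd_disc_of_dvd_middleCoeff p hn hp hc
  -- Cramer's rule: `Δ∂_A = 3B·D + 2A²·E` and `Δ∂_B = 9B·E - 2A·D`.
  have hA : h ∣ (4 * X 0 ^ 3 + 27 * X 1 ^ 2) * pderiv 0 h := by
    convert dvd_add (hD.mul_left (3 * X 1)) (hE.mul_left (2 * X 0 ^ 2)) using 1
    ring
  have hB : h ∣ (4 * X 0 ^ 3 + 27 * X 1 ^ 2) * pderiv 1 h := by
    convert dvd_sub (hE.mul_left (9 * X 1)) (hD.mul_left (2 * X 0)) using 1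
    ring
  refine hh0 (totalDegree_eq_zero_of_pderiv_eq_zero p (by omega) fun i => ?_)
  apply pderiv_eq_zero_of_dvd
  fin_cases i
  · exact (hh.dvd_mul.mp hA).resolve_left hdisc
  · exact (hh.dvd_mul.mp hB).resolve_left hdisc

end

/-! ### Irreducibility after subtracting a constant -/

/-- Eisenstein's criterion for `γ tⁿ + f` at a prime dividing `f` exactly once. -/
theorem Polynomial.irreducible_C_mul_X_pow_add_C {R : Type*} [CommRing R] [IsDomain R]
    {f q γ : R} (hq : Prime q) (hqf : q ∣ f) (hqf2 : ¬ q ^ 2 ∣ f) (hγ : IsUnit γ) {n : ℕ}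
    (hn : n ≠ 0) : Irreducible (Polynomial.C γ * Polynomial.X ^ n + Polynomial.C f) := by
  have hdeg : (Polynomial.C γ * Polynomial.X ^ n + Polynomial.C f).natDegree = n := by
    rw [Polynomial.natDegree_add_C, Polynomial.natDegree_C_mul_X_pow n γ hγ.ne_zero]
  have hcoeff : ∀ k, (Polynomial.C γ * Polynomial.X ^ n + Polynomial.C f).coeff k =
      (if k = n then γ else 0) + if k = 0 then f else 0 := fun k => by
    rw [Polynomial.coeff_add, Polynomial.coeff_C_mul_X_pow, Polynomial.coeff_C]
  have hlead : (Polynomial.C γ * Polynomial.X ^ n + Polynomial.C f).leadingCoeff = γ := by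
    rw [Polynomial.leadingCoeff, hdeg, hcoeff, if_pos rfl, if_neg hn, add_zero]
  have hprime : (Ideal.span {q}).IsPrime := (Ideal.span_singleton_prime hq.ne_zero).mpr hq
  refine Polynomial.irreducible_of_eisenstein_criterion hprime ?_ ?_ ?_ ?_ ?_
  · rw [hlead, Ideal.mem_span_singleton]
    exact fun hd => hq.not_isUnit (isUnit_of_dvd_unit hd hγ)
  · intro k hk
    have hkn : k < n := by
      rw [← hdeg]
      exact Polynomial.coe_lt_degree.mp hk
    rw [hcoeff, if_neg hkn.ne, zero_add, Ideal.mem_span_singleton]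
    split_ifs
    · exact hqf
    · exact dvd_zero q
  · rw [← Polynomial.natDegree_pos_iff_degree_pos, hdeg]
    exact Nat.pos_of_ne_zero hn
  · rwa [hcoeff, if_neg hn.symm, if_pos rfl, zero_add, Ideal.span_singleton_pow,
      Ideal.mem_span_singleton]
  · intro r hr
    rw [Polynomial.C_dvd_iff_dvd_coeff] at hr
    have := hr n
    rw [hcoeff, if_pos rfl, if_neg hn, add_zero] at this
    exact isUnit_of_dvd_unit this hγ

/-- A weighted homogeneous polynomial of positive degree with a prime factor of multiplicity one
becomes irreducible after subtracting a nonzero constant. -/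
theorem MvPolynomial.IsWeightedHomogeneous.irreducible_sub_C {σ K : Type*} [Field K] {w : σ → ℕ}
    {f q : MvPolynomial σ K} {n : ℕ} (hf : IsWeightedHomogeneous w f n) (hn : n ≠ 0)
    (hq : Prime q) (hqf : q ∣ f) (hqf2 : ¬ q ^ 2 ∣ f) {γ : K} (hγ : γ ≠ 0) :
    Irreducible (f - C γ) := by
  have hf0 : f ≠ 0 := fun h0 => hqf2 (h0 ▸ dvd_zero _)
  let φ : MvPolynomial σ K →ₐ[K] Polynomial (MvPolynomial σ K) :=
    aeval fun i => Polynomial.X ^ w i * Polynomial.C (X i)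
  have hφf : φ f = Polynomial.X ^ n * Polynomial.C f := by
    refine (hf.aeval_pow_mul (Polynomial.X : Polynomial (MvPolynomial σ K))
      fun i => Polynomial.C (X i)).trans (congrArg _ ?_)
    have hext : (aeval fun i => Polynomial.C (X i : MvPolynomial σ K)) =
        (Polynomial.CAlgHom : MvPolynomial σ K →ₐ[K] Polynomial (MvPolynomial σ K)) := by
      apply MvPolynomial.algHom_ext
      intro i
      simp
    rw [hext]
    rfl
  -- Setting `t = 1` undoes the scaling, so a factor can be recovered from its image.
  have heval : ∀ g, (φ g).eval 1 = g := by
    intro g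
    have hext : ((Polynomial.aeval (R := MvPolynomial σ K) (1 : MvPolynomial σ K)).restrictScalars
        K).comp φ = AlgHom.id K _ := by
      apply MvPolynomial.algHom_ext
      intro i
      simp [φ]
    simpa [Polynomial.coe_aeval_eq_eval] using DFunLike.congr_fun hext g
  have hφC : φ (C γ) = Polynomial.C (C γ) := φ.commutes γ
  have hCγ : IsUnit (C (-γ) : MvPolynomial σ K) := (neg_ne_zero.mpr hγ).isUnit.map C
  have hirr := Polynomial.irreducible_C_mul_X_pow_add_C hq hqf hqf2 hCγ hn
  have hform : φ (f - C γ) = Polynomial.C f * Polynomial.X ^ n + Polynomial.C (C (-γ)) := by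
    rw [map_sub, hφf, hφC, C_neg, Polynomial.C_neg]
    ring
  have hdeg : (φ (f - C γ)).natDegree = n := by
    rw [hform, Polynomial.natDegree_add_C, Polynomial.natDegree_C_mul_X_pow n f hf0]
  have hrev : (φ (f - C γ)).reverse =
      Polynomial.C (C (-γ)) * Polynomial.X ^ n + Polynomial.C f := by
    rw [Polynomial.reverse, hdeg, hform, Polynomial.reflect_add, Polynomial.reflect_C_mul_X_pow,
      Polynomial.reflect_C, Polynomial.revAt_le le_rfl, Nat.sub_self, pow_zero, mul_one, add_comm]
  -- Reversal could lose powers of `t`, but the image of a factor has nonzero constant term because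
  -- `-γ ≠ 0`.
  have hunit : ∀ g, g ∣ f - C γ → IsUnit (φ g).reverse → IsUnit g := by
    intro g hg hu
    obtain ⟨r, hr, hru⟩ := Polynomial.isUnit_iff.mp hu
    have hc0 : (φ g).coeff 0 ≠ 0 := by
      intro h0
      obtain ⟨g', hg'⟩ := hg
      have h1 : (φ (f - C γ)).coeff 0 = C (-γ) := by
        rw [hform]
        simp [hn.symm]
      rw [hg', map_mul, Polynomial.mul_coeff_zero, h0, zero_mul] at h1
      exact hCγ.ne_zero h1.symm
    have hd : (φ g).natDegree = 0 := by
      have h1 := Polynomial.reverse_natDegree (φ g)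
      rw [← hru, Polynomial.natDegree_C, Polynomial.natTrailingDegree_eq_zero.mpr (Or.inr hc0)] at h1
      omega
    rw [← heval g]
    rw [Polynomial.eq_C_of_natDegree_eq_zero hd, Polynomial.reverse_C] at hu
    rw [Polynomial.eq_C_of_natDegree_eq_zero hd, Polynomial.eval_C]
    exact Polynomial.isUnit_C.mp hu
  refine ⟨fun hu => hn ?_, fun g h hgh => ?_⟩
  · rw [← hdeg]
    exact Polynomial.natDegree_eq_zero_of_isUnit (hu.map φ)
  · rw [← hrev, hgh, map_mul, Polynomial.reverse_mul_of_domain] at hirr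
    exact (hirr.isUnit_or_isUnit rfl).imp (hunit g ⟨h, hgh⟩) (hunit h ⟨g, by rw [hgh, mul_comm]⟩)

/-! ### Assembly over the algebraic closure -/

theorem cAB_eq_middleCoeff (p : ℕ) (hp : 2 * ((p - 1) / 2) + 1 = p) :
    cAB p = middleCoeff (ZMod p) ((p - 1) / 2) := by
  unfold cAB middleCoeff
  rw [show 2 * ((p - 1) / 2) = p - 1 by omega]
  rfl

theorem mainTheorem8 (p : ℕ) [Fact p.Prime] (hp : 5 ≤ p) :
    MvPolynomial.IsWeightedHomogeneous (![2, 3] : Fin 2 → ℕ) (cAB p) ((p - 1) / 2) ∧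
    cAB p ≠ 0 ∧
    AbsolutelySquarefree (cAB p) ∧
    ∀ γ : AlgebraicClosure (ZMod p), γ ≠ 0 →
      Irreducible
        (MvPolynomial.map (algebraMap (ZMod p) (AlgebraicClosure (ZMod p))) (cAB p)
          - MvPolynomial.C γ) := by
  have hodd : 2 * ((p - 1) / 2) + 1 = p := by
    have := (Fact.out : p.Prime).eq_two_or_odd
    omega
  have hn : (p - 1) / 2 ≠ 0 := by omega
  have : CharP (AlgebraicClosure (ZMod p)) p :=
    charP_of_injective_algebraMap (algebraMap (ZMod p) _).injective p
  have hsq := squarefree_middleCoeff (K := AlgebraicClosure (ZMod p)) p hodd hp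
  have hhom := isWeightedHomogeneous_middleCoeff (AlgebraicClosure (ZMod p)) ((p - 1) / 2)
  have hne := middleCoeff_ne_zero (K := AlgebraicClosure (ZMod p)) p hodd hp
  unfold AbsolutelySquarefree
  rw [cAB_eq_middleCoeff p hodd, map_middleCoeff]
  refine ⟨isWeightedHomogeneous_middleCoeff _ _, middleCoeff_ne_zero p hodd hp, hsq,
    fun γ hγ => ?_⟩
  have hnu : ¬ IsUnit (middleCoeff (AlgebraicClosure (ZMod p)) ((p - 1) / 2)) := by
    intro hu
    obtain ⟨r, hr, hrc⟩ := MvPolynomial.isUnit_iff_eq_C_of_isReduced.mp hu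
    rw [hrc] at hhom hne
    exact hn (hhom.inj_right hne (isWeightedHomogeneous_C _ r))
  obtain ⟨q, hq, hqc⟩ := WfDvdMonoid.exists_irreducible_factor hnu hne
  exact hhom.irreducible_sub_C hn hq.prime hqc
    (fun h2 => hq.not_isUnit (hsq q (by rwa [← sq]))) hγ
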